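/- **Theorem.** Let $\mathbb{S}$ be the Sierpinski space, with carrier $2=\{0,1\}$ and open sets $\emptyset,\{1\},\{0,1\}$. Let $\mathbf{MSL}$ be the category of meet-semilattices with a top element and maps preserving finite meets and top. Read $2$ also as the meet-semilattice with $0\le 1$. For $M\in\mathbf{MSL}$, regard $\mathbf{MSL}(M,2)$ as a subspace of the power $\mathbb{S}^{|M|}$. For a topological space $X$, regard $\mathbf{Top}(X,\mathbb{S})$ as a meet-semilattice with pointwise operations. The functors $\mathbf{Top}(-,\mathbb{S})\colon \mathbf{Top}\to\mathbf{MSL}^{\mathrm{op}}$ and $\mathbf{MSL}(-,2)\colon \mathbf{MSL}^{\mathrm{op}}\to\mathbf{Top}$ form a dual adjunction $\mathbf{Top}(-,\mathbb{S})\dashv\mathbf{MSL}(-,2)$, with unit and counit given by evaluation. Let $\overline{\mathcal F}X=\mathbf{MSL}(\mathbf{Top}(X,\mathbb{S}),2)$ be the induced monad on $\mathbf{Top}$. 1. $\overline{\mathcal F}$ is isomorphic, as a monad, to the monad of filters of open sets. The latter sends a space $X$ to the set of all (possibly improper) filters $F$ of its lattice of open sets $\mathcal O(X)$, topologised inside $\mathbb{S}^{\mathcal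 O(X)}$. On a continuous map $f\colon X\to Y$ it is $F\mapsto\{V\in\mathcal O(Y) : f^{-1}V\in F\}$. Its unit sends a point to the filter of its open neighbourhoods. Its multiplication is $\mathfrak F\mapsto\{U\in\mathcal O(X) : \{F : U\in F\}\in\mathfrak F\}$. The isomorphism sends $\chi\in\overline{\mathcal F}X$ to the filter $\{U\in\mathcal O(X) : \chi(1_U)=1\}$, where $1_U$ is the characteristic map of $U$. 2. Let $\mathcal P_{\mathsf f}$ be the finite power set monad on $\mathbf{Set}$, let $\mathbf{Kl}_{\mathsf f}(\mathcal P_{\mathsf f})$ be the full subcategory of its Kleisli category given by the finite sets, and let $U_{\mathcal P_{\mathsf f}}\colon \mathbf{Kl}_{\mathsf f}(\mathcal P_{\mathsf f})\to\mathbf{Top}$ be the functor that sends a finite set $X$ to $\mathcal P_{\mathsf f}X\cong\mathbb{S}^X$ and a Kleisli morphism $f\colon X\to\mathcal P_{\mathsf f}Y$ to $A\mapsto\bigcup_{x\in A}f(x)$. Here $\mathcal P_{\mathsf f}X$, the free meet-semilattice with top on $X$ (with $\cup$ as meet and $\emptyset$ as top), is identified with the power $2^X$ of the meet-semilattice $2$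 by sending $A\subseteq X$ to the map $X\to 2$ that is $0$ exactly on $A$. Equivalently, $f$ is sent to the map $\mathbb{S}^X\to\mathbb{S}^Y$, $\varphi\mapsto\bigl(y\mapsto\bigwedge_{x:\,y\in f(x)}\varphi(x)\bigr)$. Then the right Kan extension of $U_{\mathcal P_{\mathsf f}}$ along itself exists and is pointwise, and the codensity monad of $U_{\mathcal P_{\mathsf f}}$ is isomorphic, as a monad, to $\overline{\mathcal F}$. -/

import Mathlib

open CategoryTheory Opposite TopologicalSpace

universe v₁ v₂ u₁ u₂ u

/-! ### Codensity monads -/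

section Codensity

variable {A : Type u₁} [Category.{v₁} A] {C : Type u₂} [Category.{v₂} C]

/-- The unit of the codensity monad of `F`: the transformation `𝟭 ⟶ Ran_F F` that corresponds
to the identity `F ⟶ F`. -/
noncomputable def codensityUnit (F : A ⥤ C) [F.HasRightKanExtension F] :
    𝟭 C ⟶ F.rightKanExtension F :=
  (F.rightKanExtension F).liftOfIsRightKanExtension (F.rightKanExtensionCounit F) (𝟭 C)
    F.rightUnitor.hom

/-- The multiplication of the codensity monad of `F`: with `T = Ran_F F` and counit `φ`, the
transformation `T T ⟶ T` that corresponds to `T T F ⟶ T F ⟶ F`, given by `T φ` and `φ`. -/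
noncomputable def codensityMult (F : A ⥤ C) [F.HasRightKanExtension F] :
    F.rightKanExtension F ⋙ F.rightKanExtension F ⟶ F.rightKanExtension F :=
  (F.rightKanExtension F).liftOfIsRightKanExtension (F.rightKanExtensionCounit F)
    (F.rightKanExtension F ⋙ F.rightKanExtension F)
    ((Functor.associator F (F.rightKanExtension F) (F.rightKanExtension F)).inv ≫
      Functor.whiskerRight (F.rightKanExtensionCounit F) (F.rightKanExtension F) ≫
      F.rightKanExtensionCounit F)

theorem codensityUnit_fac (F : A ⥤ C) [F.HasRightKanExtension F] (a : A) :
    (codensityUnit F).app (F.obj a) ≫ (F.rightKanExtensionCounit F).app a = 𝟙 (F.obj a) := by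
  unfold codensityUnit
  rw [Functor.liftOfIsRightKanExtension_fac_app]
  rfl

theorem codensityMult_fac (F : A ⥤ C) [F.HasRightKanExtension F] (a : A) :
    (codensityMult F).app (F.obj a) ≫ (F.rightKanExtensionCounit F).app a =
      (F.rightKanExtension F).map ((F.rightKanExtensionCounit F).app a) ≫
        (F.rightKanExtensionCounit F).app a := by
  unfold codensityMult
  rw [Functor.liftOfIsRightKanExtension_fac_app]
  simp

/-- The codensity monad of a functor `F` that has a right Kan extension along itself. -/
noncomputable def codensityMonad (F : A ⥤ C) [F.HasRightKanExtension F] : Monad C where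
  toFunctor := F.rightKanExtension F
  η := codensityUnit F
  μ := codensityMult F
  assoc X := by
    let T := F.rightKanExtension F
    let α : T ⋙ T ⋙ T ⟶ T :=
      { app := fun X => T.map ((codensityMult F).app X) ≫ (codensityMult F).app X
        naturality := fun X Y f => by
          have h1 := (codensityMult F).naturality f
          have h2 := congrArg T.map h1
          simp only [Functor.comp_map, Functor.map_comp] at h1 h2 ⊢
          erw [reassoc_of% h2, h1]
          simp [T] }
    let β : T ⋙ T ⋙ T ⟶ T :=
      { app := fun X => (codensityMult F).app (T.obj X) ≫ (codensityMult F).app X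
        naturality := fun X Y f => by
          have h1 := (codensityMult F).naturality f
          have h2 := (codensityMult F).naturality (T.map f)
          simp only [Functor.comp_map] at h1 h2 ⊢
          erw [reassoc_of% h2, h1]
          simp [T] }
    have h : α = β := by
      apply Functor.rightKanExtension_hom_ext
      ext a
      change (T.map ((codensityMult F).app (F.obj a)) ≫ (codensityMult F).app (F.obj a)) ≫
          (F.rightKanExtensionCounit F).app a =
        ((codensityMult F).app (T.obj (F.obj a)) ≫ (codensityMult F).app (F.obj a)) ≫
          (F.rightKanExtensionCounit F).app a
      have h1 := (codensityMult F).naturality ((F.rightKanExtensionCounit F).app a)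
      simp only [Functor.comp_map] at h1
      rw [Category.assoc, Category.assoc, codensityMult_fac, ← reassoc_of% h1,
        codensityMult_fac, ← Functor.map_comp_assoc, ← Functor.map_comp_assoc,
        codensityMult_fac]
    exact congrArg (fun γ : T ⋙ T ⋙ T ⟶ T => γ.app X) h
  left_unit X := by
    let T := F.rightKanExtension F
    let α : T ⟶ T :=
      { app := fun X => (codensityUnit F).app (T.obj X) ≫ (codensityMult F).app X
        naturality := fun X Y f => by
          have h1 := (codensityMult F).naturality f
          have h2 := (codensityUnit F).naturality (T.map f)
          simp only [Functor.comp_map, Functor.id_map] at h1 h2 ⊢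
          erw [reassoc_of% h2, h1]
          simp [T] }
    have h : α = 𝟙 T := by
      apply Functor.rightKanExtension_hom_ext
      ext a
      change ((codensityUnit F).app (T.obj (F.obj a)) ≫ (codensityMult F).app (F.obj a)) ≫
          (F.rightKanExtensionCounit F).app a = 𝟙 _ ≫ (F.rightKanExtensionCounit F).app a
      have h1 := (codensityUnit F).naturality ((F.rightKanExtensionCounit F).app a)
      simp only [Functor.id_map] at h1
      rw [Category.assoc, codensityMult_fac, ← reassoc_of% h1, codensityUnit_fac]
      exact (Category.comp_id _).trans (Category.id_comp _).symm
    exact congrArg (fun γ : T ⟶ T => γ.app X) h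
  right_unit X := by
    let T := F.rightKanExtension F
    let α : T ⟶ T :=
      { app := fun X => T.map ((codensityUnit F).app X) ≫ (codensityMult F).app X
        naturality := fun X Y f => by
          have h1 := (codensityMult F).naturality f
          have h2 := congrArg T.map ((codensityUnit F).naturality f)
          simp only [Functor.comp_map, Functor.id_map, Functor.map_comp] at h1 h2 ⊢
          erw [reassoc_of% h2, h1]
          simp [T] }
    have h : α = 𝟙 T := by
      apply Functor.rightKanExtension_hom_ext
      ext a
      change (T.map ((codensityUnit F).app (F.obj a)) ≫ (codensityMult F).app (F.obj a)) ≫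
          (F.rightKanExtensionCounit F).app a = 𝟙 _ ≫ (F.rightKanExtensionCounit F).app a
      rw [Category.assoc, codensityMult_fac, ← Functor.map_comp_assoc, codensityUnit_fac]
      simp
    exact congrArg (fun γ : T ⟶ T => γ.app X) h

end Codensity

/-! ### The Sierpinski space and the two-element semilattice -/

/-- The two-element set `{0, 1}` (as propositions, `0 = False` and `1 = True`). As a topological
space it is the Sierpinski space, with open sets `∅`, `{1}`, `{0, 1}`; as an ordered set it is the
two-element meet-semilattice with top element `1`. -/
abbrev Two : Type u := ULift.{u} Prop

theorem isOpen_two_iff (s : Set Two.{u}) :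
    IsOpen s ↔ s = ∅ ∨ s = {ULift.up True} ∨ s = Set.univ := by
  have key : ∀ t : Set Prop, IsOpen t ↔ (False ∈ t → True ∈ t) := by
    intro t
    have : IsOpen t ↔ ∀ p ∈ t, t ∈ nhds p := isOpen_iff_mem_nhds
    rw [this]
    constructor
    · intro h hf
      have := h False hf
      simp at this
      simp [this]
    · intro h p hp
      by_cases hh : p
      · simpa [hh] using (by simpa [hh] using hp : True ∈ t)
      · have hf : False ∈ t := by simpa [hh] using hp
        have hu : t = Set.univ := by
          ext q
          by_cases hq : q <;> simp [hq, hf, h hf]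
        simp [hu]
  have hs : IsOpen s ↔ IsOpen (ULift.up ⁻¹' s) :=
    (Homeomorph.ulift (X := Prop)).symm.isOpen_preimage.symm
  rw [hs, key]
  constructor
  · intro h
    by_cases hF : ULift.up False ∈ s
    · right; right
      ext ⟨q⟩
      by_cases hq : q
      · simpa [hq] using h hF
      · simpa [hq] using hF
    · by_cases hT : ULift.up True ∈ s
      · right; left
        ext ⟨q⟩
        by_cases hq : q <;> simp [hq, hF, hT]
      · left
        ext ⟨q⟩
        by_cases hq : q <;> simp [hq, hF, hT]
  · rintro (h | h | h) <;> simp [h]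

/-- A map into the Sierpinski space is continuous iff the preimage of `1` is open. -/
theorem continuous_two_iff {X : Type*} [TopologicalSpace X] {f : X → Two.{u}} :
    Continuous f ↔ IsOpen {x | (f x).down} := by
  rw [← continuous_Prop]
  exact ⟨fun h => continuous_uliftDown.comp h, fun h => continuous_uliftUp.comp h⟩

instance : ContinuousInf Two.{u} where
  continuous_inf := by
    rw [continuous_two_iff]
    have h : {p : Two.{u} × Two.{u} | (p.1 ⊓ p.2).down} =
        {p | p.1.down} ∩ {p | p.2.down} := rfl
    rw [h]
    exact (continuous_two_iff.1 continuous_fst).inter (continuous_two_iff.1 continuous_snd)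

/-! ### The dual adjunction between spaces and meet-semilattices with top -/

noncomputable instance (X : Type*) [TopologicalSpace X] : OrderTop C(X, Two.{u}) where
  top := ContinuousMap.const X ⊤
  le_top f := fun x => le_top (a := f x)

/-- The functor `Top(-, 𝕊) : Top ⥤ MSLᵒᵖ`; meets and top are pointwise. -/
noncomputable def topToMSL : TopCat.{u} ⥤ SemilatInfCat.{u}ᵒᵖ where
  obj X := op (SemilatInfCat.of C(X, Two.{u}))
  map {X Y} f := Quiver.Hom.op (X := SemilatInfCat.of C(Y, Two.{u}))
    (Y := SemilatInfCat.of C(X, Two.{u}))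
    (show InfTopHom C(Y, Two.{u}) C(X, Two.{u}) from
      { toFun := fun g => g.comp f.hom
        map_inf' := fun _ _ => rfl
        map_top' := rfl })

/-- The set `MSL(M, 2)` as a subspace of the power `𝕊 ^ |M|`. -/
noncomputable instance homTwoTopology (M : Type u) [SemilatticeInf M] [OrderTop M] :
    TopologicalSpace (InfTopHom M Two.{u}) :=
  TopologicalSpace.induced (fun χ => (χ : M → Two.{u})) Pi.topologicalSpace

theorem continuous_homTwo_iff {X : Type*} [TopologicalSpace X] {M : Type u} [SemilatticeInf M]
    [OrderTop M] {f : X → InfTopHom M Two.{u}} :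
    Continuous f ↔ ∀ m, Continuous fun x => f x m := by
  rw [continuous_induced_rng, continuous_pi_iff]
  rfl

theorem continuous_eval_homTwo {M : Type u} [SemilatticeInf M] [OrderTop M] (m : M) :
    Continuous fun χ : InfTopHom M Two.{u} => χ m :=
  continuous_homTwo_iff.1 continuous_id m

/-- The functor `MSL(-, 2) : MSLᵒᵖ ⥤ Top`. -/
noncomputable def mslToTop : SemilatInfCat.{u}ᵒᵖ ⥤ TopCat.{u} where
  obj M := TopCat.of (InfTopHom M.unop Two.{u})
  map {M N} h := TopCat.ofHom
    { toFun := fun χ => InfTopHom.comp χ (show InfTopHom N.unop M.unop from h.unop)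
      continuous_toFun := continuous_homTwo_iff.2 fun n =>
        continuous_eval_homTwo ((show InfTopHom N.unop M.unop from h.unop) n) }

/-- The dual adjunction `Top(-, 𝕊) ⊣ MSL(-, 2)`; unit and counit are given by evaluation. -/
noncomputable def topMSLAdjunction : topToMSL.{u} ⊣ mslToTop.{u} :=
  Adjunction.mkOfUnitCounit
    { unit :=
        { app := fun X => TopCat.ofHom
            { toFun := fun x => (show InfTopHom C(X, Two.{u}) Two.{u} from
                { toFun := fun g => g x
                  map_inf' := fun _ _ => rfl
                  map_top' := rfl })
              continuous_toFun := continuous_homTwo_iff.2 fun g => g.continuous }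
          naturality := fun _ _ _ => rfl }
      counit :=
        { app := fun M => Quiver.Hom.op (X := M.unop)
            (Y := SemilatInfCat.of C(InfTopHom M.unop Two.{u}, Two.{u}))
            (show InfTopHom M.unop C(InfTopHom M.unop Two.{u}, Two.{u}) from
              { toFun := fun m => ⟨fun χ => χ m, continuous_eval_homTwo m⟩
                map_inf' := fun a b => ContinuousMap.ext fun χ => map_inf χ a b
                map_top' := ContinuousMap.ext fun χ => map_top χ })
          naturality := fun _ _ _ => rfl }
      left_triangle := rfl
      right_triangle := rfl }

/-- The monad `X ↦ MSL(Top(X, 𝕊), 2)` on `Top` induced by the dual adjunction. -/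
noncomputable def dualFilterMonad : Monad TopCat.{u} := topMSLAdjunction.{u}.toMonad

/-! ### The monad of filters of open sets -/

/-- The filters of open sets of `X` (the filters of the meet-semilattice of open sets). -/
abbrev OpenFilter (X : Type u) [TopologicalSpace X] : Type u := Order.PFilter (Opens X)

/-- The space of filters of open sets, topologised inside the power of `𝕊` indexed by the open
sets. -/
noncomputable instance openFilterTopology (X : Type u) [TopologicalSpace X] :
    TopologicalSpace (OpenFilter X) :=
  TopologicalSpace.induced (fun (F : OpenFilter X) (U : Opens X) => (ULift.up (U ∈ F) : Two.{u}))
    Pi.topologicalSpace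

theorem continuous_openFilter_iff {Y : Type*} [TopologicalSpace Y] {X : Type u}
    [TopologicalSpace X] {f : Y → OpenFilter X} :
    Continuous f ↔ ∀ U : Opens X, IsOpen {y | U ∈ f y} := by
  rw [continuous_induced_rng, continuous_pi_iff]
  exact forall_congr' fun U => continuous_two_iff

/-- The open set `□U` of all filters that contain the open set `U`. -/
def boxOpen {X : Type u} [TopologicalSpace X] (U : Opens X) : Opens (OpenFilter X) :=
  ⟨{F | U ∈ F}, continuous_openFilter_iff.1 continuous_id U⟩

/-- A set of open sets that contains the whole space, is closed under binary intersections and is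
upwards closed, as a filter. -/
def mkOpenFilter {X : Type u} [TopologicalSpace X] (p : Opens X → Prop) (h_top : p ⊤)
    (h_inf : ∀ U V, p U → p V → p (U ⊓ V)) (h_le : ∀ U V, U ≤ V → p U → p V) : OpenFilter X :=
  (Order.IsPFilter.of_def (F := {U | p U}) ⟨⊤, h_top⟩
    (fun U hU V hV => ⟨U ⊓ V, h_inf U V hU hV, inf_le_left, inf_le_right⟩)
    (fun {U V} hUV hU => h_le U V hUV hU)).toPFilter

theorem mem_mkOpenFilter {X : Type u} [TopologicalSpace X] (p : Opens X → Prop) (h_top : p ⊤)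
    (h_inf : ∀ U V, p U → p V → p (U ⊓ V)) (h_le : ∀ U V, U ≤ V → p U → p V) (U : Opens X) :
    U ∈ mkOpenFilter p h_top h_inf h_le ↔ p U := Iff.rfl

theorem openFilter_ext {X : Type u} [TopologicalSpace X] {F G : OpenFilter X}
    (h : ∀ U, U ∈ F ↔ U ∈ G) : F = G := SetLike.ext h

/-- The image filter `{V | f⁻¹ V ∈ F}`. -/
def openFilterMap {X Y : Type u} [TopologicalSpace X] [TopologicalSpace Y] (f : C(X, Y))
    (F : OpenFilter X) : OpenFilter Y :=
  mkOpenFilter (fun V => Opens.comap f V ∈ F) Order.PFilter.top_mem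
    (fun _ _ hU hV => Order.PFilter.inf_mem hU hV)
    (fun _ _ h hU => Order.PFilter.mem_of_le (fun _ hx => h hx) hU)

/-- The filter of open neighbourhoods of a point. -/
def openNhds {X : Type u} [TopologicalSpace X] (x : X) : OpenFilter X :=
  mkOpenFilter (fun U => x ∈ U) trivial (fun _ _ hU hV => ⟨hU, hV⟩) (fun _ _ h hU => h hU)

/-- The filter `{U | □U ∈ 𝔉}`. -/
def openFilterJoin {X : Type u} [TopologicalSpace X] (𝔉 : OpenFilter (OpenFilter X)) :
    OpenFilter X :=
  mkOpenFilter (fun U => boxOpen U ∈ 𝔉)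
    (by
      have h : boxOpen (⊤ : Opens X) = ⊤ := by
        ext F
        exact ⟨fun _ => trivial, fun _ => Order.PFilter.top_mem⟩
      rw [h]
      exact Order.PFilter.top_mem)
    (fun U V hU hV => Order.PFilter.mem_of_le
      (show boxOpen U ⊓ boxOpen V ≤ boxOpen (U ⊓ V) from
        fun _ hF => Order.PFilter.inf_mem hF.1 hF.2) (Order.PFilter.inf_mem hU hV))
    (fun U V h hU => Order.PFilter.mem_of_le
      (show boxOpen U ≤ boxOpen V from fun _ hF => Order.PFilter.mem_of_le h hF) hU)

/-- The endofunctor of `Top` that sends a space to its space of filters of open sets. -/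
noncomputable def openFilterFunctor : TopCat.{u} ⥤ TopCat.{u} where
  obj X := TopCat.of (OpenFilter X)
  map {X Y} f := TopCat.ofHom
    { toFun := openFilterMap f.hom
      continuous_toFun := continuous_openFilter_iff.2 fun V =>
        (boxOpen (Opens.comap f.hom V)).isOpen }

/-- The monad of filters of open sets on `Top`: the unit sends a point to the filter of its open
neighbourhoods, the multiplication sends `𝔉` to `{U | {F | U ∈ F} ∈ 𝔉}`. -/
noncomputable def openFilterMonad : Monad TopCat.{u} where
  toFunctor := openFilterFunctor
  η :=
    { app := fun X => TopCat.ofHom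
        { toFun := openNhds (X := X)
          continuous_toFun := continuous_openFilter_iff.2 fun U => U.isOpen }
      naturality := fun _ _ _ => rfl }
  μ :=
    { app := fun X => TopCat.ofHom
        { toFun := openFilterJoin (X := X)
          continuous_toFun := continuous_openFilter_iff.2 fun U => (boxOpen (boxOpen U)).isOpen }
      naturality := fun _ _ _ => rfl }
  assoc _ := rfl
  left_unit _ := rfl
  right_unit _ := rfl

/-- The characteristic map `X → 𝕊` of an open set. -/
def openChar {X : Type u} [TopologicalSpace X] (U : Opens X) : C(X, Two.{u}) :=
  ⟨fun x => ⟨x ∈ U⟩, continuous_two_iff.2 U.isOpen⟩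

/-- The filter `χ⁻¹(1)` that corresponds to a semilattice morphism `χ : Top(X, 𝕊) → 2`, where open
sets are identified with their characteristic maps. -/
def filterOfHom {X : Type u} [TopologicalSpace X] (χ : InfTopHom C(X, Two.{u}) Two.{u}) :
    OpenFilter X :=
  mkOpenFilter (fun U => (χ (openChar U)).down)
    (by
      have h : openChar (⊤ : Opens X) = ⊤ := rfl
      rw [h, map_top]
      trivial)
    (fun U V hU hV => by
      have h : openChar (U ⊓ V) = openChar U ⊓ openChar V := rfl
      rw [h, map_inf]
      exact ⟨hU, hV⟩)
    (fun U V hUV hU => by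
      have h : openChar U ≤ openChar V := fun x hx => hUV hx
      exact (OrderHomClass.mono χ h : χ (openChar U) ≤ χ (openChar V)) hU)

/-! ### Finite sets and relations -/

open Classical in
/-- The finite power set monad on the category of sets. -/
noncomputable def finPowerset : Monad (Type u) := ofTypeMonad Finset

/-- The full subcategory of the Kleisli category of the finite power set monad given by the finite
sets. -/
abbrev KlFin : Type (u + 1) :=
  ObjectProperty.FullSubcategory fun X : Kleisli finPowerset.{u} => Finite X.of

/-- The functor from finite Kleisli objects to sets that sends `X` to the set of (finite) subsets
of `X` and `f` to `A ↦ ⋃ x ∈ A, f x`. -/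
noncomputable def klFinToSet : KlFin.{u} ⥤ Type u :=
  ObjectProperty.ι _ ⋙ Kleisli.Adjunction.fromKleisli finPowerset

open Classical in
/-- The identification of the set of subsets of a finite set `X` with `𝕊 ^ X`: the bijection
that turns the free meet-semilattice with top on `X` (the subsets of `X`, with `∪` as the meet and
`∅` as the top) into the power of the two-element meet-semilattice. It sends `A` to the map that is
`0` exactly on `A`. -/
noncomputable def subsetsEquivPower (X : KlFin.{u}) :
    klFinToSet.obj X ≃ (X.obj.of → Two.{u}) :=
  haveI : Finite X.obj.of := X.property
  { toFun := fun (A : Finset X.obj.of) x => ⟨x ∉ A⟩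
    invFun := fun φ => ((Set.toFinite {x | ¬ (φ x).down}).toFinset : Finset X.obj.of)
    left_inv := fun (A : Finset X.obj.of) => by
      refine Finset.ext fun x => ?_
      simp
    right_inv := fun φ => by
      funext x
      refine ULift.ext _ _ ?_
      simp }

theorem subsetsEquivPower_union (X : KlFin.{u}) [DecidableEq X.obj.of] (A B : Finset X.obj.of) :
    subsetsEquivPower X (A ∪ B : Finset X.obj.of) =
      subsetsEquivPower X A ⊓ subsetsEquivPower X B := by
  funext x
  refine ULift.ext _ _ (propext ?_)
  change x ∉ A ∪ B ↔ x ∉ A ∧ x ∉ B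
  simp

/-- A morphism of `KlFin` as a map `f : X → P_f Y`. -/
def KlFin.toFun {X Y : KlFin.{u}} (f : X ⟶ Y) (x : X.obj.of) : Finset Y.obj.of := f.hom.of x

theorem mem_klFinToSet_map {X Y : KlFin.{u}} (f : X ⟶ Y) (A : Finset X.obj.of) (y : Y.obj.of) :
    y ∈ (show Finset Y.obj.of from klFinToSet.map f A) ↔ ∃ x ∈ A, y ∈ KlFin.toFun f x := by
  classical
  have h : (show Finset Y.obj.of from klFinToSet.map f A) =
      Finset.sup (Finset.image (KlFin.toFun f) A) id := by
    change joinM (KlFin.toFun f <$> A) = _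
    simp only [joinM, Finset.bind_def, Finset.fmap_def]
    congr!
  rw [h]
  simp [Finset.mem_sup]

theorem subsetsEquivPower_map {X Y : KlFin.{u}} (f : X ⟶ Y) (φ : X.obj.of → Two.{u})
    (y : Y.obj.of) :
    (subsetsEquivPower Y (klFinToSet.map f ((subsetsEquivPower X).symm φ)) y).down ↔
      ∀ x, y ∈ KlFin.toFun f x → (φ x).down := by
  have h := mem_klFinToSet_map f ((subsetsEquivPower X).symm φ) y
  change ¬ (y ∈ (show Finset Y.obj.of from _)) ↔ _
  rw [h]
  have h2 : ∀ x, x ∈ (show Finset X.obj.of from (subsetsEquivPower X).symm φ) ↔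
      ¬ (φ x).down := by
    intro x
    exact Set.Finite.mem_toFinset _
  constructor
  · intro hn x hx
    by_contra hc
    exact hn ⟨x, (h2 x).2 hc, hx⟩
  · rintro hn ⟨x, hx, hy⟩
    exact (h2 x).1 hx (hn x hy)

/-- The functor from finite Kleisli objects to topological spaces that sends `X` to `𝕊 ^ X`: it is
`klFinToSet`, transported along the identification of subsets of `X` with points of `𝕊 ^ X`. -/
noncomputable def klFinToTop : KlFin.{u} ⥤ TopCat.{u} where
  obj X := TopCat.of (X.obj.of → Two.{u})
  map {X Y} f := TopCat.ofHom
    { toFun := fun φ => subsetsEquivPower Y (klFinToSet.map f ((subsetsEquivPower X).symm φ))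
      continuous_toFun := by
        have : Finite X.obj.of := X.property
        refine continuous_pi fun y => continuous_two_iff.2 ?_
        simp only [subsetsEquivPower_map, Set.ofPred_forall]
        exact isOpen_iInter_of_finite fun x => isOpen_iInter_of_finite fun _ =>
          continuous_two_iff.1 (continuous_apply x) }
  map_id X := by
    ext φ
    simp
  map_comp f g := by
    ext φ
    simp

/-!
Finite free meet-semilattices are dense in `MSL`. A cone over the arrows from them to `M` is
determined by its values at one-generator arrows, that is, at the elements of `M`, because every
element of a free semilattice is the image of a generator; two-element and empty families make
these values preserve `⊓` and `⊤`. Take `M = Top(X, 𝕊)`. By adjunction, the arrows from `M` to free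
semilattices in `MSLᵒᵖ` are the arrows from `X` to the powers `𝕊 ^ I = MSL(P_f I, 2)`, and the right
adjoint `MSL(-, 2) : MSLᵒᵖ ⥤ Top` preserves limits. So `X ↦ MSL(Top(X, 𝕊), 2)` satisfies the limit
formula for the right Kan extension of `I ↦ 𝕊 ^ I` along itself.
-/

/-! ### Codensity monads of right adjoints -/

section CodensityComparison

variable {A : Type u₁} [Category.{v₁} A] {C : Type u₂} [Category.{v₂} C]
variable (F : A ⥤ C) [F.HasRightKanExtension F]

/-- The comparison between a right Kan extension of `F` along itself and the underlying functor of
the codensity monad of `F`. -/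
noncomputable def codensityComparison (T : C ⥤ C) (φ : F ⋙ T ⟶ F) [T.IsRightKanExtension φ] :
    T ≅ F.rightKanExtension F :=
  Functor.rightKanExtensionUnique T φ (F.rightKanExtension F) (F.rightKanExtensionCounit F)

theorem codensityComparison_hom_fac (T : C ⥤ C) (φ : F ⋙ T ⟶ F) [T.IsRightKanExtension φ] (a : A) :
    (codensityComparison F T φ).hom.app (F.obj a) ≫ (F.rightKanExtensionCounit F).app a =
      φ.app a := by
  rw [codensityComparison, Functor.rightKanExtensionUnique_hom]
  exact Functor.liftOfIsRightKanExtension_fac_app _ _ T φ a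

variable (T : Monad C) (φ : F ⋙ T.toFunctor ⟶ F) [T.toFunctor.IsRightKanExtension φ]

theorem unit_comp_codensityComparison
    (hη : ∀ a, T.η.app (F.obj a) ≫ φ.app a = 𝟙 (F.obj a)) :
    T.η ≫ (codensityComparison F T.toFunctor φ).hom = codensityUnit F := by
  apply Functor.rightKanExtension_hom_ext
  ext a
  change (T.η.app (F.obj a) ≫ (codensityComparison F T.toFunctor φ).hom.app (F.obj a)) ≫
      (F.rightKanExtensionCounit F).app a =
    (codensityUnit F).app (F.obj a) ≫ (F.rightKanExtensionCounit F).app a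
  rw [Category.assoc, codensityComparison_hom_fac, hη, codensityUnit_fac]

theorem mult_comp_codensityComparison
    (hμ : ∀ a, T.μ.app (F.obj a) ≫ φ.app a = T.map (φ.app a) ≫ φ.app a) :
    T.μ ≫ (codensityComparison F T.toFunctor φ).hom =
      ((codensityComparison F T.toFunctor φ).hom ◫ (codensityComparison F T.toFunctor φ).hom) ≫
        codensityMult F := by
  apply Functor.rightKanExtension_hom_ext
  ext a
  let i := (codensityComparison F T.toFunctor φ).hom
  change (T.μ.app (F.obj a) ≫ i.app (F.obj a)) ≫ (F.rightKanExtensionCounit F).app a =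
    ((i.app (T.obj (F.obj a)) ≫ (F.rightKanExtension F).map (i.app (F.obj a))) ≫
      (codensityMult F).app (F.obj a)) ≫ (F.rightKanExtensionCounit F).app a
  have hi : i.app (F.obj a) ≫ (F.rightKanExtensionCounit F).app a = φ.app a :=
    codensityComparison_hom_fac F T.toFunctor φ a
  rw [Category.assoc, hi, hμ, Category.assoc, codensityMult_fac, Category.assoc,
    ← Functor.map_comp_assoc, hi, ← NatTrans.naturality_assoc, hi]

/-- A monad whose underlying functor is a right Kan extension of `F` along itself, with a counit
that is compatible with the unit and the multiplication, is the codensity monad of `F`. -/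
noncomputable def monadIsoCodensityMonad
    (hη : ∀ a, T.η.app (F.obj a) ≫ φ.app a = 𝟙 (F.obj a))
    (hμ : ∀ a, T.μ.app (F.obj a) ≫ φ.app a = T.map (φ.app a) ≫ φ.app a) :
    T ≅ codensityMonad F :=
  MonadIso.mk (N := codensityMonad F) (codensityComparison F T.toFunctor φ)
    (fun X => NatTrans.congr_app (unit_comp_codensityComparison F T φ hη) X)
    (fun X => (NatTrans.congr_app (mult_comp_codensityComparison F T φ hμ) X).trans <|
      congrArg (· ≫ (codensityMult F).app X)
        ((codensityComparison F T.toFunctor φ).hom.naturality _).symm)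

end CodensityComparison

section Codense

variable {A : Type*} [Category* A] {C : Type*} [Category* C] {D : Type*} [Category* D]

/-- A witness that `K` is codense: the identity is a pointwise right Kan extension of `K` along
itself. -/
abbrev Codense (K : A ⥤ D) :=
  (Functor.RightExtension.mk (𝟭 D) K.rightUnitor.hom).IsPointwiseRightKanExtension

/-- The component at `g : X ⟶ K a` of a cone over the category of arrows from `X` to `K`. -/
def arrowLeg {K : A ⥤ D} {G : A ⥤ C} {X : D} (s : Limits.Cone (StructuredArrow.proj X K ⋙ G))
    {a : A} (g : X ⟶ K.obj a) : s.pt ⟶ G.obj a :=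
  s.π.app (StructuredArrow.mk g)

theorem arrowLeg_comp_map {K : A ⥤ D} {G : A ⥤ C} {X : D}
    (s : Limits.Cone (StructuredArrow.proj X K ⋙ G)) {a b : A} (g : X ⟶ K.obj a) (f : a ⟶ b) :
    arrowLeg s g ≫ G.map f = arrowLeg s (g ≫ K.map f) :=
  s.w (StructuredArrow.homMk f : StructuredArrow.mk g ⟶ StructuredArrow.mk (g ≫ K.map f))

/-- Codensity of `K` from a universal property stated for arrows instead of structured arrows. -/
def Codense.ofLift {K : A ⥤ D}
    (lift : ∀ {Y : D} (s : Limits.Cone (StructuredArrow.proj Y K ⋙ K)), s.pt ⟶ Y)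
    (lift_comp : ∀ {Y : D} (s : Limits.Cone (StructuredArrow.proj Y K ⋙ K)) {a : A}
      (g : Y ⟶ K.obj a), lift s ≫ g = arrowLeg s g)
    (eq_lift : ∀ {Y : D} (s : Limits.Cone (StructuredArrow.proj Y K ⋙ K)) (f : s.pt ⟶ Y),
      (∀ {a : A} (g : Y ⟶ K.obj a), f ≫ g = arrowLeg s g) → f = lift s) :
    Codense K := fun _ =>
  { lift := lift
    fac := fun s g => (congrArg (lift s ≫ ·) (Category.comp_id g.hom)).trans (lift_comp s g.hom)
    uniq := fun s f hf => eq_lift s f fun g =>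
      (congrArg (f ≫ ·) (Category.comp_id g).symm).trans (hf (StructuredArrow.mk g)) }

/-- The map into `Y` induced by a cone over the category of arrows from `Y` to a codense
functor. -/
def Codense.lift {K : A ⥤ D} (hK : Codense K) {Y : D}
    (s : Limits.Cone (StructuredArrow.proj Y K ⋙ K)) : s.pt ⟶ Y :=
  Limits.IsLimit.lift (hK Y) s

theorem Codense.lift_comp {K : A ⥤ D} (hK : Codense K) {Y : D}
    (s : Limits.Cone (StructuredArrow.proj Y K ⋙ K)) {a : A} (g : Y ⟶ K.obj a) :
    hK.lift s ≫ g = arrowLeg s g :=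
  (congrArg (Limits.IsLimit.lift (hK Y) s ≫ ·) (Category.comp_id g).symm).trans
    (Limits.IsLimit.fac (hK Y) s (StructuredArrow.mk g))

theorem Codense.hom_ext {K : A ⥤ D} (hK : Codense K) {Y Z : D} {f f' : Z ⟶ Y}
    (h : ∀ (a : A) (g : Y ⟶ K.obj a), f ≫ g = f' ≫ g) : f = f' :=
  Functor.RightExtension.IsPointwiseRightKanExtensionAt.hom_ext' (hK Y) fun a g =>
    (congrArg (f ≫ ·) (Category.comp_id g)).trans <|
      (h a g).trans (congrArg (f' ≫ ·) (Category.comp_id g).symm)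

variable {L : C ⥤ D} {U : D ⥤ C} (adj : L ⊣ U) {K : A ⥤ D} {F : A ⥤ C} (e : K ⋙ U ≅ F)

/-- The bijection between arrows `L X ⟶ K a` and arrows `X ⟶ U K a ≅ F a`. -/
def transposeEquiv (X : C) (a : A) : (L.obj X ⟶ K.obj a) ≃ (X ⟶ F.obj a) :=
  (adj.homEquiv X (K.obj a)).trans (e.app a).homToEquiv

theorem transposeEquiv_comp_map {X : C} {a b : A} (g : L.obj X ⟶ K.obj a) (f : a ⟶ b) :
    transposeEquiv adj e X b (g ≫ K.map f) = transposeEquiv adj e X a g ≫ F.map f := by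
  have he : U.map (K.map f) ≫ e.hom.app b = e.hom.app a ≫ F.map f := e.hom.naturality f
  simp [transposeEquiv, Adjunction.homEquiv_unit, he]

theorem transposeEquiv_symm_comp_map {X : C} {a b : A} (g : X ⟶ F.obj a) (f : a ⟶ b) :
    (transposeEquiv adj e X a).symm g ≫ K.map f =
      (transposeEquiv adj e X b).symm (g ≫ F.map f) := by
  rw [Equiv.eq_symm_apply, transposeEquiv_comp_map, Equiv.apply_symm_apply]

/-- The transformation `U L F ≅ U L U K ⟶ U K ≅ F` given by the counit of `L ⊣ U`. -/
def adjunctionKanCounit : F ⋙ L ⋙ U ⟶ F where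
  app a := (L ⋙ U).map (e.inv.app a) ≫ U.map (adj.counit.app (K.obj a)) ≫ e.hom.app a
  naturality a b f := by
    have hε := congrArg U.map (adj.counit.naturality (K.map f))
    have hinv := congrArg (L ⋙ U).map (e.inv.naturality f)
    have hhom := e.hom.naturality f
    simp only [Functor.comp_map, Functor.id_map, Functor.map_comp] at hε hinv hhom ⊢
    rw [reassoc_of% hinv, reassoc_of% hε, hhom]
    simp only [Category.assoc]

theorem comp_adjunctionKanCounit {X Y : C} {a : A} (m : Y ⟶ U.obj (L.obj X)) (g : X ⟶ F.obj a) :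
    m ≫ U.map (L.map g) ≫ (adjunctionKanCounit adj e).app a =
      transposeEquiv adj e Y a
        ((adj.homEquiv Y (L.obj X)).symm m ≫ (transposeEquiv adj e X a).symm g) := by
  simp [adjunctionKanCounit, transposeEquiv, Adjunction.homEquiv_unit, Adjunction.homEquiv_counit]

/-- The transpose of a cone over the arrows `X ⟶ F a` to a cone over the arrows `L X ⟶ K a`. -/
def transposeCone {X : C} (s : Limits.Cone (StructuredArrow.proj X F ⋙ F)) :
    Limits.Cone (StructuredArrow.proj (L.obj X) K ⋙ K) where
  pt := L.obj s.pt
  π :=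
    { app := fun g => (transposeEquiv adj e s.pt g.right).symm
        (arrowLeg s (transposeEquiv adj e X g.right g.hom))
      naturality := fun g h m => by
        refine (Category.id_comp _).trans ?_
        change _ = _ ≫ K.map m.right
        rw [transposeEquiv_symm_comp_map, arrowLeg_comp_map, ← transposeEquiv_comp_map,
          StructuredArrow.w] }

/-- The map `Z ⟶ U L X` induced by a cone with point `Z` over the arrows `X ⟶ F a`, as an arrow
`L Z ⟶ L X`. -/
def transposeLift (hK : Codense K) {X : C} (s : Limits.Cone (StructuredArrow.proj X F ⋙ F)) :
    L.obj s.pt ⟶ L.obj X :=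
  hK.lift (transposeCone adj e s)

theorem transposeLift_comp (hK : Codense K) {X : C}
    (s : Limits.Cone (StructuredArrow.proj X F ⋙ F)) {a : A} (g : L.obj X ⟶ K.obj a) :
    transposeLift adj e hK s ≫ g =
      (transposeEquiv adj e s.pt a).symm (arrowLeg s (transposeEquiv adj e X a g)) :=
  hK.lift_comp (transposeCone adj e s) g

/-- If `K` is codense and `L ⊣ U`, then `U L` is a pointwise right Kan extension of `U K` along
itself. -/
def adjunctionIsPointwiseRightKanExtension (hK : Codense K) :
    (Functor.RightExtension.mk (L ⋙ U) (adjunctionKanCounit adj e)).IsPointwiseRightKanExtension :=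
  fun X =>
  { lift := fun s => adj.homEquiv s.pt (L.obj X) (transposeLift adj e hK s)
    fac := fun s g => by
      refine (comp_adjunctionKanCounit adj e _ g.hom).trans ?_
      rw [Equiv.symm_apply_apply, transposeLift_comp, Equiv.apply_symm_apply,
        Equiv.apply_symm_apply]
      rfl
    uniq := fun s m hm => by
      refine ((adj.homEquiv _ _).symm_apply_eq).1 (hK.hom_ext fun a g => ?_)
      have hleg := (comp_adjunctionKanCounit adj e m (transposeEquiv adj e X a g)).symm.trans
        (hm (StructuredArrow.mk (transposeEquiv adj e X a g)))
      rw [transposeLift_comp, Equiv.eq_symm_apply]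
      rwa [Equiv.symm_apply_apply] at hleg }

theorem unit_comp_adjunctionKanCounit (a : A) :
    adj.unit.app (F.obj a) ≫ (adjunctionKanCounit adj e).app a = 𝟙 (F.obj a) := by
  have h := comp_adjunctionKanCounit adj e (adj.unit.app (F.obj a)) (𝟙 (F.obj a))
  simpa [Adjunction.homEquiv_counit] using h

theorem mult_comp_adjunctionKanCounit (a : A) :
    U.map (adj.counit.app (L.obj (F.obj a))) ≫ (adjunctionKanCounit adj e).app a =
      (L ⋙ U).map ((adjunctionKanCounit adj e).app a) ≫ (adjunctionKanCounit adj e).app a := by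
  have hε := congrArg U.map (adj.counit.naturality (L.map (e.inv.app a) ≫ adj.counit.app (K.obj a)))
  simp only [Functor.comp_map, Functor.id_map, Functor.map_comp, Category.assoc] at hε
  simp only [adjunctionKanCounit, Functor.comp_map, Functor.map_comp, Category.assoc]
  rw [← reassoc_of% hε]
  simp

/-- If `K` is codense and `L ⊣ U`, then the monad `U L` is the codensity monad of `U K`. -/
noncomputable def adjunctionMonadIsoCodensityMonad (hK : Codense K) [F.HasRightKanExtension F] :
    adj.toMonad ≅ codensityMonad F :=
  have : adj.toMonad.toFunctor.IsRightKanExtension (adjunctionKanCounit adj e) :=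
    (adjunctionIsPointwiseRightKanExtension adj e hK).isRightKanExtension
  monadIsoCodensityMonad F adj.toMonad (adjunctionKanCounit adj e)
    (unit_comp_adjunctionKanCounit adj e) (mult_comp_adjunctionKanCounit adj e)

end Codense

/-! ### Finite free meet-semilattices -/

section FreeMeetSemilattice

variable {I M N : Type*} [DecidableEq I] [SemilatticeInf M] [OrderTop M] [SemilatticeInf N]
  [OrderTop N]

/-- The free meet-semilattice with top on `I`: the finite subsets of `I`, with `∪` as the meet and
`∅` as the top. -/
abbrev FreeMSL (I : Type*) : Type _ := (Finset I)ᵒᵈ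

/-- The generator of the free meet-semilattice given by `i`. -/
def freeGenerator (i : I) : FreeMSL I := OrderDual.toDual {i}

theorem freeHom_ext {α β : InfTopHom (FreeMSL I) M}
    (h : ∀ i, α (freeGenerator i) = β (freeGenerator i)) : α = β := by
  ext B
  induction B using OrderDual.rec with | toDual B
  induction B using Finset.induction_on with
  | empty => exact (map_top α).trans (map_top β).symm
  | insert i B _ ih =>
    have hinsert : OrderDual.toDual (insert i B) = freeGenerator i ⊓ OrderDual.toDual B := rfl
    rw [hinsert, map_inf, map_inf, h, ih]

/-- The universal property of the free meet-semilattice. -/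
def freeHomEquiv : InfTopHom (FreeMSL I) M ≃ (I → M) where
  toFun α i := α (freeGenerator i)
  invFun g :=
    { toFun := fun B => (OrderDual.ofDual B).inf g
      map_inf' := fun _ _ => Finset.inf_union
      map_top' := Finset.inf_empty }
  left_inv _ := freeHom_ext fun _ => Finset.inf_singleton
  right_inv _ := funext fun _ => Finset.inf_singleton

theorem comp_freeHomEquiv_symm (β : InfTopHom M N) (g : I → M) :
    β.comp (freeHomEquiv.symm g) = freeHomEquiv.symm (β ∘ g) :=
  InfTopHom.ext fun B => map_finset_inf β (OrderDual.ofDual B) g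

end FreeMeetSemilattice

section FreeFunctor

noncomputable instance (X : KlFin.{u}) : DecidableEq X.obj.of := Classical.decEq _

instance (X : KlFin.{u}) : Finite X.obj.of := X.property

/-- The set `{x | y ∈ f x}`, for `f : X → P_f Y`. -/
noncomputable def KlFin.fiber {X Y : KlFin.{u}} (f : X ⟶ Y) (y : Y.obj.of) : FreeMSL X.obj.of :=
  OrderDual.toDual (Set.toFinite {x | y ∈ KlFin.toFun f x}).toFinset

theorem KlFin.mem_fiber {X Y : KlFin.{u}} (f : X ⟶ Y) (x : X.obj.of) (y : Y.obj.of) :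
    x ∈ OrderDual.ofDual (KlFin.fiber f y) ↔ y ∈ KlFin.toFun f x :=
  Set.Finite.mem_toFinset _

theorem KlFin.mem_toFun_id {X : KlFin.{u}} (x y : X.obj.of) :
    y ∈ KlFin.toFun (𝟙 X) x ↔ y = x :=
  Finset.mem_singleton

theorem KlFin.mem_toFun_comp {X Y Z : KlFin.{u}} (f : X ⟶ Y) (g : Y ⟶ Z) (x : X.obj.of)
    (z : Z.obj.of) :
    z ∈ KlFin.toFun (f ≫ g) x ↔ ∃ y ∈ KlFin.toFun f x, z ∈ KlFin.toFun g y :=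
  mem_klFinToSet_map g (KlFin.toFun f x) z

theorem KlFin.fiber_id {X : KlFin.{u}} (y : X.obj.of) :
    KlFin.fiber (𝟙 X) y = freeGenerator y := by
  refine Finset.ext fun x => (KlFin.mem_fiber _ _ _).trans ?_
  rw [KlFin.mem_toFun_id, eq_comm]
  exact Finset.mem_singleton.symm

theorem KlFin.fiber_comp {X Y Z : KlFin.{u}} (f : X ⟶ Y) (g : Y ⟶ Z) (z : Z.obj.of) :
    KlFin.fiber (f ≫ g) z = (OrderDual.ofDual (KlFin.fiber g z)).inf (KlFin.fiber f) := by
  refine Finset.ext fun x => (KlFin.mem_fiber _ _ _).trans ?_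
  refine Iff.trans ?_ Finset.mem_sup.symm
  rw [KlFin.mem_toFun_comp]
  refine exists_congr fun y => ?_
  rw [← KlFin.mem_fiber, ← KlFin.mem_fiber, and_comm]
  rfl

/-- The functor that sends a finite set `X` to the free meet-semilattice on `X`, and `f` to the
morphism that sends the generator `y` to `{x | y ∈ f x}`. -/
noncomputable def freeMSL : KlFin.{u} ⥤ SemilatInfCat.{u}ᵒᵖ where
  obj X := op (SemilatInfCat.of (FreeMSL X.obj.of))
  map {X Y} f := Quiver.Hom.op (X := SemilatInfCat.of (FreeMSL Y.obj.of))
    (Y := SemilatInfCat.of (FreeMSL X.obj.of))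
    (show InfTopHom (FreeMSL Y.obj.of) (FreeMSL X.obj.of) from freeHomEquiv.symm (KlFin.fiber f))
  map_id _ := congrArg Quiver.Hom.op <| freeHom_ext fun y =>
    Finset.inf_singleton.trans (KlFin.fiber_id y)
  map_comp f g := congrArg Quiver.Hom.op <| freeHom_ext fun z =>
    Finset.inf_singleton.trans <| (KlFin.fiber_comp f g z).trans <|
      congrArg (fun B => Finset.inf (OrderDual.ofDual B) (KlFin.fiber f))
        (Finset.inf_singleton).symm

end FreeFunctor

/-! ### Codensity of the finite free meet-semilattices -/

section FreeCodense

variable {M : SemilatInfCat.{u}ᵒᵖ} {X Y : KlFin.{u}}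

/-- A family `X → M`, as an arrow of `MSLᵒᵖ` from `M` to the free meet-semilattice on `X`. -/
noncomputable def freeArrow (g : X.obj.of → M.unop) : M ⟶ freeMSL.obj X :=
  Quiver.Hom.op (X := SemilatInfCat.of (FreeMSL X.obj.of)) (Y := M.unop)
    (show InfTopHom (FreeMSL X.obj.of) M.unop from freeHomEquiv.symm g)

/-- An arrow of `MSLᵒᵖ` to a free meet-semilattice, as a semilattice morphism out of it. -/
noncomputable def infTopHomOfArrow (α : M ⟶ freeMSL.obj X) : InfTopHom (FreeMSL X.obj.of) M.unop :=
  α.unop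

theorem exists_eq_freeArrow (α : M ⟶ freeMSL.obj X) : ∃ g, α = freeArrow g :=
  ⟨freeHomEquiv (infTopHomOfArrow α), congrArg Quiver.Hom.op (freeHomEquiv.symm_apply_apply _).symm⟩

theorem freeArrow_comp_map (g : X.obj.of → M.unop) (f : X ⟶ Y) :
    freeArrow g ≫ freeMSL.map f =
      freeArrow fun y => (OrderDual.ofDual (KlFin.fiber f y)).inf g :=
  congrArg Quiver.Hom.op (comp_freeHomEquiv_symm (freeHomEquiv.symm g) (KlFin.fiber f))

/-- A finite set as an object of `KlFin`. -/
noncomputable def KlFin.of (I : Type u) [hI : Finite I] : KlFin.{u} := ⟨Kleisli.mk _ I, hI⟩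

/-- A subset `B` of `X`, as the Kleisli morphism to a one-element set `*` with `fiber * = B`. -/
noncomputable def KlFin.ofSubset (B : FreeMSL X.obj.of) : X ⟶ KlFin.of PUnit.{u + 1} :=
  ObjectProperty.homMk <| Kleisli.Hom.mk <| TypeCat.ofHom fun x : X.obj.of =>
    (if x ∈ OrderDual.ofDual B then {PUnit.unit} else ∅ : Finset PUnit.{u + 1})

theorem KlFin.fiber_ofSubset (B : FreeMSL X.obj.of)
    (y : (KlFin.of PUnit.{u + 1}).obj.of) : KlFin.fiber (KlFin.ofSubset B) y = B := by
  refine Finset.ext fun x => (KlFin.mem_fiber _ _ _).trans ?_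
  change y ∈ (if x ∈ OrderDual.ofDual B then {PUnit.unit} else ∅ : Finset PUnit.{u + 1}) ↔
    x ∈ OrderDual.ofDual B
  split_ifs with hx
  · exact iff_of_true (Finset.mem_singleton.2 rfl) hx
  · exact iff_of_false (Finset.notMem_empty _) hx

variable (s : Limits.Cone (StructuredArrow.proj M freeMSL ⋙ freeMSL))

/-- The leg of a cone at a family `g`, as a map of semilattices. -/
noncomputable def coneLegHom (g : X.obj.of → M.unop) : InfTopHom (FreeMSL X.obj.of) s.pt.unop :=
  infTopHomOfArrow (arrowLeg s (freeArrow g))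

/-- The value at `m` of the map `M → s.pt` induced by a cone: the image of the generator under the
leg at the one-element family `m`. -/
noncomputable def coneValue (m : M.unop) : s.pt.unop :=
  coneLegHom s (X := KlFin.of PUnit.{u + 1}) (fun _ => m) (freeGenerator PUnit.unit)

theorem coneLegHom_fiber (g : X.obj.of → M.unop) (f : X ⟶ Y) (y : Y.obj.of) :
    coneLegHom s g (KlFin.fiber f y) =
      coneLegHom s (fun y => (OrderDual.ofDual (KlFin.fiber f y)).inf g) (freeGenerator y) := by
  have h := (arrowLeg_comp_map s (freeArrow g) f).trans
    (congrArg (arrowLeg s) (freeArrow_comp_map g f))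
  refine Eq.trans ?_ (DFunLike.congr_fun (congrArg infTopHomOfArrow h) _)
  exact congrArg (coneLegHom s g) Finset.inf_singleton.symm

theorem coneLegHom_apply (g : X.obj.of → M.unop) (B : FreeMSL X.obj.of) :
    coneLegHom s g B = coneValue s ((OrderDual.ofDual B).inf g) :=
  calc coneLegHom s g B
    _ = coneLegHom s g (KlFin.fiber (KlFin.ofSubset B) PUnit.unit) :=
      congrArg (coneLegHom s g) (KlFin.fiber_ofSubset B PUnit.unit).symm
    _ = _ := coneLegHom_fiber s g (KlFin.ofSubset B) PUnit.unit
    _ = coneValue s ((OrderDual.ofDual B).inf g) :=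
      congrArg (fun k => coneLegHom s k (freeGenerator PUnit.unit)) <| funext fun y =>
        congrArg (fun B => (OrderDual.ofDual B).inf g) (KlFin.fiber_ofSubset B y)

theorem coneValue_apply (g : X.obj.of → M.unop) (x : X.obj.of) :
    coneValue s (g x) = coneLegHom s g (freeGenerator x) :=
  (congrArg (coneValue s) Finset.inf_singleton.symm).trans
    (coneLegHom_apply s g (freeGenerator x)).symm

theorem coneValue_top : coneValue s (⊤ : M.unop) = ⊤ :=
  (coneLegHom_apply s (X := KlFin.of PUnit.{u + 1}) (fun _ => ⊤) ⊤).symm.trans (map_top _)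

theorem coneValue_inf (m n : M.unop) : coneValue s (m ⊓ n) = coneValue s m ⊓ coneValue s n := by
  let g : (KlFin.of (ULift.{u} Bool)).obj.of → M.unop := fun b => cond b.down m n
  let i : (KlFin.of (ULift.{u} Bool)).obj.of := ⟨true⟩
  let j : (KlFin.of (ULift.{u} Bool)).obj.of := ⟨false⟩
  have hg : (OrderDual.ofDual (freeGenerator i ⊓ freeGenerator j)).inf g = m ⊓ n := by
    refine Finset.inf_union.trans ?_
    exact congrArg₂ (· ⊓ ·) Finset.inf_singleton Finset.inf_singleton
  have h : coneLegHom s g (freeGenerator i ⊓ freeGenerator j) =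
      coneLegHom s g (freeGenerator i) ⊓ coneLegHom s g (freeGenerator j) := map_inf _ _ _
  rw [coneLegHom_apply, hg, ← coneValue_apply, ← coneValue_apply] at h
  exact h

/-- The map `M → s.pt` induced by a cone. -/
noncomputable def coneHom : InfTopHom M.unop s.pt.unop where
  toFun := coneValue s
  map_inf' := coneValue_inf s
  map_top' := coneValue_top s

/-- The map `M → s.pt` induced by a cone, as an arrow of `MSLᵒᵖ`. -/
noncomputable def coneLift : s.pt ⟶ M :=
  Quiver.Hom.op (X := M.unop) (Y := s.pt.unop) (coneHom s)

theorem coneLift_comp (α : M ⟶ freeMSL.obj X) : coneLift s ≫ α = arrowLeg s α := by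
  obtain ⟨g, rfl⟩ := exists_eq_freeArrow α
  exact congrArg Quiver.Hom.op <| InfTopHom.ext fun B => (coneLegHom_apply s g B).symm

theorem eq_coneLift (f : s.pt ⟶ M)
    (hf : ∀ {X : KlFin.{u}} (α : M ⟶ freeMSL.obj X), f ≫ α = arrowLeg s α) :
    f = coneLift s := by
  refine congrArg Quiver.Hom.op <| InfTopHom.ext fun m => ?_
  have h := DFunLike.congr_fun (congrArg infTopHomOfArrow
    (hf (freeArrow (X := KlFin.of PUnit.{u + 1}) fun _ => m))) (freeGenerator PUnit.unit)
  have hm : Finset.inf {PUnit.unit} (fun _ => m) = m := Finset.inf_singleton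
  exact (congrArg (show InfTopHom M.unop s.pt.unop from f.unop) hm.symm).trans h

/-- The finite free meet-semilattices are codense in `MSLᵒᵖ`, that is, dense in `MSL`. -/
noncomputable def freeMSLCodense : Codense freeMSL.{u} :=
  Codense.ofLift coneLift (fun s _ α => coneLift_comp s α) (fun s f hf => eq_coneLift s f hf)

end FreeCodense

/-! ### Powers of the Sierpinski space -/

section Powers

theorem down_inf_iff {I : Type*} (B : Finset I) (φ : I → Two.{u}) :
    (B.inf φ).down ↔ ∀ i ∈ B, (φ i).down := by
  classical
  induction B using Finset.induction_on with
  | empty => exact iff_of_true trivial (by simp)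
  | insert i B _ ih =>
    rw [Finset.inf_insert, Finset.forall_mem_insert, ← ih]
    rfl

/-- The semilattice morphisms from the free meet-semilattice on `I` to `2` form the power
`𝕊 ^ I`. -/
noncomputable def freeHomTwoHomeomorph (I : Type u) [DecidableEq I] :
    InfTopHom (FreeMSL I) Two.{u} ≃ₜ (I → Two.{u}) where
  toEquiv := freeHomEquiv
  continuous_toFun := continuous_pi fun i => continuous_eval_homTwo (freeGenerator i)
  continuous_invFun := continuous_homTwo_iff.2 fun _ =>
    Continuous.finset_inf_apply fun i _ => continuous_apply i

theorem freeHomEquiv_comp_fiber {X Y : KlFin.{u}} (f : X ⟶ Y) (φ : X.obj.of → Two.{u}) :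
    freeHomEquiv ((freeHomEquiv.symm φ).comp (freeHomEquiv.symm (KlFin.fiber f))) =
      klFinToTop.map f φ := by
  rw [comp_freeHomEquiv_symm, Equiv.apply_symm_apply]
  funext y
  refine ULift.ext _ _ (propext ?_)
  calc ((OrderDual.ofDual (KlFin.fiber f y)).inf φ).down
    _ ↔ ∀ x, y ∈ KlFin.toFun f x → (φ x).down := by simp only [down_inf_iff, KlFin.mem_fiber]
    _ ↔ (klFinToTop.map f φ y).down := (subsetsEquivPower_map f φ y).symm

/-- The composite of the free meet-semilattice functor with `MSL(-, 2)` is `X ↦ 𝕊 ^ X`. -/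
noncomputable def freeMSLCompMslToTopIso : freeMSL.{u} ⋙ mslToTop ≅ klFinToTop :=
  NatIso.ofComponents (fun X => TopCat.isoOfHomeo (freeHomTwoHomeomorph X.obj.of)) fun f =>
    TopCat.hom_ext <| ContinuousMap.ext fun χ => by
      obtain ⟨φ, rfl⟩ := freeHomEquiv.symm.surjective χ
      exact (freeHomEquiv_comp_fiber f φ).trans
        (congrArg (klFinToTop.map f) (freeHomEquiv.apply_symm_apply φ).symm)

end Powers

/-! ### Filters of open sets -/

section Filters

/-- The characteristic morphism `M → 2` of a filter. -/
noncomputable def characteristicHom {M : Type*} [SemilatticeInf M] [OrderTop M]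
    (F : Order.PFilter M) : InfTopHom M Two.{u} where
  toFun m := ⟨m ∈ F⟩
  map_inf' _ _ := ULift.ext _ _ (propext Order.PFilter.inf_mem_iff)
  map_top' := ULift.ext _ _ (eq_true Order.PFilter.top_mem)

variable {X : Type u} [TopologicalSpace X]

/-- The open set on which a map into the Sierpinski space takes the value `1`, as a morphism of
semilattices. -/
def openOfMap : InfTopHom C(X, Two.{u}) (Opens X) where
  toFun g := ⟨{x | (g x).down}, continuous_two_iff.1 g.continuous⟩
  map_inf' _ _ := rfl
  map_top' := rfl

variable (X) in
/-- Semilattice morphisms `Top(X, 𝕊) → 2` are the same as filters of open sets, topologically. -/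
noncomputable def homFilterHomeomorph :
    InfTopHom C(X, Two.{u}) Two.{u} ≃ₜ OpenFilter X where
  toFun := filterOfHom
  invFun F := (characteristicHom F).comp openOfMap
  left_inv _ := rfl
  right_inv _ := rfl
  continuous_toFun := continuous_openFilter_iff.2 fun U =>
    continuous_two_iff.1 (continuous_eval_homTwo (openChar U))
  continuous_invFun := continuous_homTwo_iff.2 fun g =>
    continuous_two_iff.2 (boxOpen (openOfMap g)).isOpen

/-- The dual filter monad is the monad of filters of open sets. -/
noncomputable def dualFilterMonadIso : dualFilterMonad.{u} ≅ openFilterMonad.{u} :=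
  MonadIso.mk (M := dualFilterMonad.{u}) (N := openFilterMonad.{u})
    (NatIso.ofComponents (F := dualFilterMonad.{u}.toFunctor) (G := openFilterMonad.{u}.toFunctor)
      (fun X => TopCat.isoOfHomeo (homFilterHomeomorph X)) (fun _ => rfl))
    (fun _ => rfl) (fun _ => rfl)

end Filters

theorem mainTheorem4 :
    (∃ e : dualFilterMonad.{u} ≅ openFilterMonad.{u},
      ∀ (X : TopCat.{u}) (χ : InfTopHom C(X, Two.{u}) Two.{u}),
        e.hom.app X χ = filterOfHom χ) ∧
    ∃ _ : klFinToTop.{u}.HasPointwiseRightKanExtension klFinToTop.{u},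
      Nonempty (dualFilterMonad.{u} ≅ codensityMonad klFinToTop.{u}) := by
  have hRan := adjunctionIsPointwiseRightKanExtension topMSLAdjunction.{u}
    freeMSLCompMslToTopIso freeMSLCodense
  have := hRan.hasPointwiseRightKanExtension
  exact ⟨⟨dualFilterMonadIso, fun _ _ => rfl⟩, this,
    ⟨adjunctionMonadIsoCodensityMonad topMSLAdjunction freeMSLCompMslToTopIso freeMSLCodense⟩⟩
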